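/- All manifolds are smooth, Hausdorff, compact and connected (orientations play no role). Write $T^n=\mathbb R^n/\mathbb Z^n$, $\mathbb R^n_{\ge 0}=\{\xi\in\mathbb R^n:\xi_i\ge 0 \text{ for all } i\}$, and let $D_\epsilon(\xi_0)\subset\mathbb R^n$ be the open Euclidean disc with centre $\xi_0$ and radius $\epsilon$. Define $\mu_{\mathbb C^n}:\mathbb C^n\to\mathbb R^n_{\ge0}$ by $\mu_{\mathbb C^n}(z)=(|z_1|^2,\dots,|z_n|^2)$ and $\nu_{\mathbb C^n}:\mathbb R^n_{\ge 0}\times T^n\to\mathbb C^n$ by $\nu_{\mathbb C^n}(\xi,\theta)=(\sqrt{\xi_i}\,e^{2\pi\sqrt{-1}\,\theta_i})_i$. Let $n\ge 0$, let $B$ be an $n$-dimensional manifold with corners (locally modelled on $\mathbb R^n_{\ge0}$), let $\pi_P:P\to B$ be a principal $SL_n(\mathbb Z)$-bundle, and let $\pi_T:T^n_P=P\times_{SL_n(\mathbb Z)}T^n\to B$ be the associated torus bundle. A $2n$-dimensional twisted toric manifold associated with $P$ consists of a $2n$-dimensional manifold $X$ without boundary and surjective continuous maps $\nu:T^n_P\to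 X$, $\mu:X\to B$ with $\mu\circ\nu=\pi_T$ such that for every $b\in B$ there are (i) a diffeomorphism $\varphi^B$ of an open neighbourhood $U$ of $b$ onto $\mathbb R^n_{\ge 0}\cap D_\epsilon(\xi_0)$ for some $\epsilon>0$, where $\xi_0=\varphi^B(b)$, (ii) a trivialization of $P$ over $U$ as a principal bundle, with induced trivialization $\varphi^T:\pi_T^{-1}(U)\cong U\times T^n$, and (iii) a diffeomorphism $\varphi^X:\mu^{-1}(U)\cong\mu_{\mathbb C^n}^{-1}(D_\epsilon(\xi_0))$, with $\varphi^B\circ\mu=\mu_{\mathbb C^n}\circ\varphi^X$ on $\mu^{-1}(U)$ and $\varphi^X\circ\nu=\nu_{\mathbb C^n}\circ(\varphi^B\times\mathrm{id}_{T^n})\circ\varphi^T$ on $\pi_T^{-1}(U)$. A corner point of $B$ is a point of its $0$-dimensional stratum, that is, a point all of whose $n$ coordinates vanish in a chart of $B$ (with values in $\mathbb R^n_{\ge0}$) at that point. Theorem. Let $(X,\nu,\mu)$ be a twisted toric manifold associated with a principal $SL_n(\mathbb Z)$-bundle on $B$. If $B$ has at least one corner point, then for all $x_0\in X$ and $b=\mu(x_0)$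 the homomorphism $\mu_*:\pi_1(X,x_0)\to\pi_1(B,b)$ induced by $\mu$ is an isomorphism. -/

import Mathlib

open scoped Manifold ContDiff

noncomputable section

namespace TwistedToric

/-- The group `SL_n(ℤ)`, with its (discrete) topology. -/
abbrev SLZ (n : ℕ) : Type := Matrix.SpecialLinearGroup (Fin n) ℤ

/-- The torus `T^n = ℝ^n / ℤ^n`. -/
abbrev Torus (n : ℕ) : Type := Fin n → AddCircle (1 : ℝ)

/-- The space `ℂ^n` with its Hermitian norm. -/
abbrev CSpace (n : ℕ) : Type := EuclideanSpace ℂ (Fin n)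

/-- The model of manifolds with corners: the quadrant `{ξ ∈ ℝ^n | ξ_i ≥ 0 for all i}`. -/
abbrev IQ (n : ℕ) : ModelWithCorners ℝ (EuclideanSpace ℝ (Fin n)) (EuclideanQuadrant n) :=
  modelWithCornersEuclideanQuadrant n

/-- The natural action of `SL_n(ℤ)` on `T^n = ℝ^n / ℤ^n` by matrix multiplication. -/
def torusAct {n : ℕ} (g : SLZ n) (θ : Torus n) : Torus n :=
  fun i => ∑ j, (g.1 i j) • θ j

theorem torusAct_one {n : ℕ} (θ : Torus n) : torusAct (1 : SLZ n) θ = θ := by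
  funext i
  simp [torusAct, Matrix.one_apply, ite_smul]

theorem torusAct_mul {n : ℕ} (g h : SLZ n) (θ : Torus n) :
    torusAct (g * h) θ = torusAct g (torusAct h θ) := by
  funext i
  simp only [torusAct, Matrix.SpecialLinearGroup.coe_mul, Matrix.mul_apply, Finset.sum_smul,
    Finset.smul_sum, mul_smul]
  exact Finset.sum_comm

/-- A trivialization of `πP` is equivariant for the right actions of `SL_n(ℤ)`;
the right action on `P` is written as an action of the opposite group. -/
def IsEquivariantTriv {n : ℕ} {B P : Type*} [TopologicalSpace B] [TopologicalSpace P]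
    [MulAction (SLZ n)ᵐᵒᵖ P] {πP : P → B} (e : Bundle.Trivialization (SLZ n) πP) : Prop :=
  ∀ p : P, πP p ∈ e.baseSet → ∀ g : SLZ n, (e (MulOpposite.op g • p)).2 = (e p).2 * g

/-- `πP : P → B` is a principal `SL_n(ℤ)`-bundle, with right action of `SL_n(ℤ)`. -/
structure IsPrincipalSLBundle (n : ℕ) {B P : Type*} [TopologicalSpace B] [TopologicalSpace P]
    [MulAction (SLZ n)ᵐᵒᵖ P] (πP : P → B) : Prop where
  continuous_act : ∀ g : SLZ n, Continuous fun p : P => MulOpposite.op g • p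
  proj_act : ∀ (g : SLZ n) (p : P), πP (MulOpposite.op g • p) = πP p
  locally_trivial : ∀ b : B, ∃ e : Bundle.Trivialization (SLZ n) πP,
    b ∈ e.baseSet ∧ IsEquivariantTriv e

/-- The relation `(p · g, θ) ∼ (p, g θ)` on `P × T^n`. -/
def torusSetoid (n : ℕ) (P : Type*) [MulAction (SLZ n)ᵐᵒᵖ P] : Setoid (P × Torus n) where
  r a b := ∃ g : SLZ n, a.1 = MulOpposite.op g • b.1 ∧ torusAct g a.2 = b.2
  iseqv :=
    { refl := fun a => ⟨1, by simp, torusAct_one _⟩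
      symm := by
        rintro a b ⟨g, h1, h2⟩
        refine ⟨g⁻¹, ?_, ?_⟩
        · rw [h1, smul_smul, ← MulOpposite.op_mul, mul_inv_cancel, MulOpposite.op_one, one_smul]
        · rw [← h2, ← torusAct_mul, inv_mul_cancel, torusAct_one]
      trans := by
        rintro a b c ⟨g, h1, h2⟩ ⟨k, h3, h4⟩
        refine ⟨k * g, ?_, ?_⟩
        · rw [h1, h3, smul_smul, MulOpposite.op_mul]
        · rw [torusAct_mul, h2, h4] }

/-- The total space `T^n_P = P ×_{SL_n(ℤ)} T^n` of the associated torus bundle. -/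
def TorusBundle (n : ℕ) (P : Type*) [MulAction (SLZ n)ᵐᵒᵖ P] : Type _ :=
  Quotient (torusSetoid n P)

/-- The quotient topology on `T^n_P`. -/
instance (n : ℕ) (P : Type*) [TopologicalSpace P] [MulAction (SLZ n)ᵐᵒᵖ P] :
    TopologicalSpace (TorusBundle n P) :=
  inferInstanceAs (TopologicalSpace (Quotient (torusSetoid n P)))

/-- The class `[p, θ]` in `T^n_P`. -/
def TorusBundle.mk {n : ℕ} {P : Type*} [MulAction (SLZ n)ᵐᵒᵖ P] (p : P) (θ : Torus n) :
    TorusBundle n P :=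
  Quotient.mk (torusSetoid n P) (p, θ)

/-- The bundle projection `π_T : T^n_P → B`, `[p, θ] ↦ πP p`. -/
def TorusBundle.proj {n : ℕ} {B P : Type*} [TopologicalSpace B] [TopologicalSpace P]
    [MulAction (SLZ n)ᵐᵒᵖ P] {πP : P → B} (hP : IsPrincipalSLBundle n πP) :
    TorusBundle n P → B :=
  Quotient.lift (fun a : P × Torus n => πP a.1) (by
    rintro a b ⟨g, h1, -⟩
    rw [h1, hP.proj_act])

/-- The moment map `μ_{ℂ^n}(z) = (|z_1|², …, |z_n|²)`. -/
def momentC {n : ℕ} (z : CSpace n) : EuclideanSpace ℝ (Fin n) :=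
  WithLp.toLp 2 fun i => ‖z i‖ ^ 2

/-- The map `ν_{ℂ^n}(ξ, θ) = (√ξ_i · exp(2π√-1 θ_i))_i`. -/
def nuC {n : ℕ} (ξ : EuclideanQuadrant n) (θ : Torus n) : CSpace n :=
  WithLp.toLp 2 fun i => (Real.sqrt (ξ.1 i) : ℂ) * (AddCircle.toCircle (θ i) : ℂ)

/-- A locally toric chart around `b`. It consists of
* a diffeomorphism `φB` of an open neighbourhood `U = φB.source` of `b` onto the intersection of
  the quadrant with an open Euclidean disc of radius `ε > 0` centred at `φB b`;
* an equivariant trivialization `φP` of `P` over `U`;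
* a diffeomorphism `φX` of `μ⁻¹(U)` onto the preimage of that disc under `μ_{ℂ^n}`,
such that `φB ∘ μ = μ_{ℂ^n} ∘ φX` on `μ⁻¹(U)` and
`φX ∘ ν = ν_{ℂ^n} ∘ (φB × id) ∘ φT` on `π_T⁻¹(U)`, where `φT` is the trivialization of `T^n_P`
over `U` induced by `φP`, that is, `φT [p, θ] = (πP p, g_p θ)` if `φP p = (πP p, g_p)`. -/
structure LocallyToricChart (n : ℕ) {B X P : Type*}
    [TopologicalSpace B] [ChartedSpace (EuclideanQuadrant n) B]
    [TopologicalSpace X] [ChartedSpace (EuclideanSpace ℝ (Fin (2 * n))) X]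
    [TopologicalSpace P] [MulAction (SLZ n)ᵐᵒᵖ P]
    (πP : P → B) (ν : TorusBundle n P → X) (μ : X → B) (b : B) where
  φB : PartialDiffeomorph (IQ n) (IQ n) B (EuclideanQuadrant n) ∞
  φP : Bundle.Trivialization (SLZ n) πP
  φX : PartialDiffeomorph 𝓘(ℝ, EuclideanSpace ℝ (Fin (2 * n))) 𝓘(ℝ, CSpace n) X (CSpace n) ∞
  ε : ℝ
  ε_pos : 0 < ε
  mem_source : b ∈ φB.source
  target_φB : φB.target = {ξ | ξ.1 ∈ Metric.ball (φB b).1 ε}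
  baseSet_φP : φP.baseSet = φB.source
  equivariant_φP : IsEquivariantTriv φP
  source_φX : φX.source = μ ⁻¹' φB.source
  target_φX : φX.target = {z | momentC z ∈ Metric.ball (φB b).1 ε}
  moment_comm : ∀ x : X, μ x ∈ φB.source → (φB (μ x)).1 = momentC (φX x)
  torus_comm : ∀ (p : P) (θ : Torus n), πP p ∈ φB.source →
    φX (ν (TorusBundle.mk p θ)) = nuC (φB (πP p)) (torusAct (φP p).2 θ)

/-- `(X, ν, μ)` is a `2n`-dimensional twisted toric manifold associated with the principal
`SL_n(ℤ)`-bundle `πP : P → B` on the `n`-dimensional manifold with corners `B`. -/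
structure IsTwistedToricManifold (n : ℕ) {B X P : Type*}
    [TopologicalSpace B] [ChartedSpace (EuclideanQuadrant n) B]
    [TopologicalSpace X] [ChartedSpace (EuclideanSpace ℝ (Fin (2 * n))) X]
    [TopologicalSpace P] [MulAction (SLZ n)ᵐᵒᵖ P]
    {πP : P → B} (hP : IsPrincipalSLBundle n πP)
    (ν : TorusBundle n P → X) (μ : X → B) : Prop where
  continuous_ν : Continuous ν
  continuous_μ : Continuous μ
  surjective_ν : Function.Surjective ν
  surjective_μ : Function.Surjective μ
  proj_comm : ∀ y : TorusBundle n P, μ (ν y) = TorusBundle.proj hP y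
  exists_chart : ∀ b : B, Nonempty (LocallyToricChart n πP ν μ b)

/-- The number `n(b)` of coordinates of `b` that vanish in a chart at `b`. -/
def cornerIndex (n : ℕ) {B : Type*} [TopologicalSpace B] [ChartedSpace (EuclideanQuadrant n) B]
    (b : B) : ℕ :=
  Set.ncard {i : Fin n | (chartAt (EuclideanQuadrant n) b b).1 i = 0}

/-- The stratum of dimension `k` of an `n`-dimensional manifold with corners:
the points `b` with `n(b) = n - k`. -/
def stratum (n : ℕ) (B : Type*) [TopologicalSpace B] [ChartedSpace (EuclideanQuadrant n) B]
    (k : ℕ) : Set B :=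
  {b | cornerIndex n b + k = n}

/-- Corner points are the points of the `0`-dimensional stratum. -/
def IsCornerPoint (n : ℕ) {B : Type*} [TopologicalSpace B] [ChartedSpace (EuclideanQuadrant n) B]
    (b : B) : Prop :=
  b ∈ stratum n B 0

end TwistedToric

end

/-! The zero section of the torus bundle is fixed by `SL_n(ℤ)`, so it descends to a continuous
section `ζ` of `μ`, and `μ_*` is surjective. Each point x = ν[p, w] is joined to `ζ (μ x)` inside
its fibre by the radial path t ↦ ν[p, t w]. If these paths give classes natural in x, then every
loop `γ` at x is conjugate, through the radial path, to its image under `ζ ∘ μ`; a loop killed by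
`μ_*` is therefore null-homotopic (`bijective_mapOfEq_of_natural`).

The obstacle is that w is not unique. Two choices differ by integers in the coordinates where the
base point is nonzero, and arbitrarily where it vanishes, since ν collapses those circles. So the
class of the radial path is well defined once the integral torus loops t ↦ ν[p, t v] are
null-homotopic (`IsRadial.homotopic`). At a corner point the whole torus collapses and these loops
are constant. Their triviality at b is a locally constant condition on b, because a chart carries
such a loop along a segment, and B is connected (`torusLoopsTrivial`).

Naturality is local: on a small neighbourhood the polar coordinates of the end points of a path can
be interpolated linearly (`exists_nhds_natural`), and subdivision gives all paths. -/

noncomputable section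

namespace TwistedToric

open scoped Topology unitInterval

open Path.Homotopic.Quotient (mk)

/-! ### Homotopies of paths and a criterion for an isomorphism on fundamental groups. -/

section Homotopy

variable {X : Type*} [TopologicalSpace X]

/-- Paths that are images of paths in a convex set with the same endpoints are homotopic. -/
theorem homotopic_of_convex {E : Type*} [AddCommGroup E] [Module ℝ E] [TopologicalSpace E]
    [IsTopologicalAddGroup E] [ContinuousSMul ℝ E] {K : Set E} (hK : Convex ℝ K) {f : E → X}
    (hf : ContinuousOn f K) {x y : X} {p q : Path x y} {k l : I → E} (hk : Continuous k)
    (hl : Continuous l) (hkK : ∀ t, k t ∈ K) (hlK : ∀ t, l t ∈ K) (h0 : k 0 = l 0)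
    (h1 : k 1 = l 1) (hp : ∀ t, p t = f (k t)) (hq : ∀ t, q t = f (l t)) : p.Homotopic q := by
  have hmem : ∀ z : I × I, (1 - (z.1 : ℝ)) • k z.2 + (z.1 : ℝ) • l z.2 ∈ K := fun z =>
    hK (hkK _) (hlK _) (by linarith [z.1.2.2]) z.1.2.1 (by ring)
  refine ⟨⟨⟨⟨fun z => f ((1 - (z.1 : ℝ)) • k z.2 + (z.1 : ℝ) • l z.2), ?_⟩, ?_, ?_⟩, ?_⟩⟩
  · exact hf.comp_continuous (by fun_prop) hmem
  · intro t; simp [hp]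
  · intro t; simp [hq]
  · rintro t s (rfl | rfl)
    · simp [h0, ← add_smul, ← hq]
    · simp [h1, ← add_smul, ← hq]

/-- The two ways around the boundary of a singular square are homotopic. -/
theorem homotopic_of_square (F : C(I × I, X)) {a b c d : X} {l : Path a b} {top : Path b d}
    {bot : Path a c} {r : Path c d} (hl : ∀ t, l t = F (0, t)) (htop : ∀ s, top s = F (s, 1))
    (hbot : ∀ s, bot s = F (s, 0)) (hr : ∀ t, r t = F (1, t)) :
    (l.trans top).Homotopic (bot.trans r) := by
  obtain rfl : a = F (0, 0) := by rw [← hl, l.source]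
  obtain rfl : b = F (0, 1) := by rw [← hl, l.target]
  obtain rfl : c = F (1, 0) := by rw [← hr, r.source]
  obtain rfl : d = F (1, 1) := by rw [← hr, r.target]
  -- Clamping extends the square to the plane, whose simple connectedness makes the two boundary
  -- paths homotopic.
  let G : C(ℝ × ℝ, X) := F.comp
    ⟨fun z => (Set.projIcc 0 1 zero_le_one z.1, Set.projIcc 0 1 zero_le_one z.2), by fun_prop⟩
  have hG : ∀ s t : I, G (s, t) = F (s, t) := fun s t => by simp [G]
  let L : Path ((0 : ℝ), (0 : ℝ)) (0, 1) := ⟨⟨fun t => (0, (t : ℝ)), by fun_prop⟩, by simp, by simp⟩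
  let T : Path ((0 : ℝ), (1 : ℝ)) (1, 1) := ⟨⟨fun t => ((t : ℝ), 1), by fun_prop⟩, by simp, by simp⟩
  let D : Path ((0 : ℝ), (0 : ℝ)) (1, 0) := ⟨⟨fun t => ((t : ℝ), 0), by fun_prop⟩, by simp, by simp⟩
  let R : Path ((1 : ℝ), (0 : ℝ)) (1, 1) := ⟨⟨fun t => (1, (t : ℝ)), by fun_prop⟩, by simp, by simp⟩
  have h := (SimplyConnectedSpace.paths_homotopic (L.trans T) (D.trans R)).map G
  have e0 : F (0, 0) = G (0, 0) := (hG 0 0).symm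
  have e1 : F (1, 1) = G (1, 1) := (hG 1 1).symm
  have h' := h.pathCast e0 e1
  have e1 : ((L.trans T).map G.continuous).cast e0 e1 = l.trans top := by
    ext t
    simp only [Path.map_coe, Path.cast_coe, Function.comp, Path.trans_apply]
    split_ifs
    · rw [hl]; exact hG 0 _
    · rw [htop]; exact hG _ 1
  have e2 : ((D.trans R).map G.continuous).cast e0 (hG 1 1).symm = bot.trans r := by
    ext t
    simp only [Path.map_coe, Path.cast_coe, Function.comp, Path.trans_apply]
    split_ifs
    · rw [hbot]; exact hG _ 0
    · rw [hr]; exact hG 1 _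
  rwa [e1, e2] at h'

/-- A family of classes of paths from `f x` to `x` that is natural for short paths
is natural for all paths. -/
theorem natural_of_locally_natural (f : C(X, X)) (c : ∀ x, Path.Homotopic.Quotient (f x) x)
    (hc : ∀ x₀, ∃ V ∈ 𝓝 x₀, ∀ (x y : X) (γ : Path x y), (∀ t, γ t ∈ V) →
      (c x).trans (mk γ) = (mk (γ.map f.continuous)).trans (c y))
    {x y : X} (γ : Path x y) :
    (c x).trans (mk γ) = (mk (γ.map f.continuous)).trans (c y) := by
  choose V hV hVc using hc
  -- Lebesgue subdivision: each piece of `γ` lies in one neighbourhood, and naturality is preserved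
  -- by concatenation.
  obtain ⟨t, ht0, htm, ⟨m, hm⟩, ht⟩ := exists_monotone_Icc_subset_open_cover_unitInterval
    (c := fun x => γ ⁻¹' interior (V x)) (fun x => isOpen_interior.preimage γ.continuous)
    (fun s _ => Set.mem_iUnion.2 ⟨γ s, mem_interior_iff_mem_nhds.2 (hV _)⟩)
  have key : ∀ k, (c (γ 0)).trans (mk (γ.subpath 0 (t k))) =
      (mk ((γ.subpath 0 (t k)).map f.continuous)).trans (c (γ (t k))) := by
    intro k
    induction k with
    | zero =>
      rw [ht0, Path.subpath_self]
      change (c (γ 0)).trans (Path.Homotopic.Quotient.refl _) =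
        (Path.Homotopic.Quotient.refl _).trans (c (γ 0))
      simp
    | succ k ih =>
      obtain ⟨x, hx⟩ := ht k
      have h1 := hVc x _ _ (γ.subpath (t k) (t (k + 1))) (fun s => by
        have : γ.subpath (t k) (t (k + 1)) s ∈ Set.range (γ.subpath (t k) (t (k + 1))) := ⟨s, rfl⟩
        rw [Path.range_subpath_of_le _ _ _ (htm (Nat.le_succ k))] at this
        obtain ⟨u, hu, hu'⟩ := this
        rw [← hu']
        exact interior_subset (hx hu))
      have h2 : mk (γ.subpath 0 (t (k + 1))) =
          (mk (γ.subpath 0 (t k))).trans (mk (γ.subpath (t k) (t (k + 1)))) :=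
        (Path.Homotopic.Quotient.eq.2 ⟨Path.Homotopy.subpathTransSubpath γ 0 _ _⟩).symm
      have h3 : mk ((γ.subpath 0 (t (k + 1))).map f.continuous) =
          (mk ((γ.subpath 0 (t k)).map f.continuous)).trans
            (mk ((γ.subpath (t k) (t (k + 1))).map f.continuous)) := by
        rw [← Path.Homotopic.Quotient.mk_trans, ← Path.map_trans]
        exact (Path.Homotopic.Quotient.eq.2
          (Path.Homotopic.map ⟨Path.Homotopy.subpathTransSubpath γ 0 _ _⟩ f)).symm
      rw [h2, h3, ← Path.Homotopic.Quotient.trans_assoc, ih, Path.Homotopic.Quotient.trans_assoc,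
        h1, Path.Homotopic.Quotient.trans_assoc]
  have aux : ∀ {u v : X} (p : Path u v) (hx : x = u) (hy : y = v),
      (c u).trans (mk p) = (mk (p.map f.continuous)).trans (c v) →
      (c x).trans (mk (p.cast hx hy)) =
        (mk ((p.cast hx hy).map f.continuous)).trans (c y) := by
    rintro _ _ p rfl rfl h
    exact h
  have h := key m
  rw [hm m le_rfl] at h
  have e : γ = (γ.subpath 0 1).cast γ.source.symm γ.target.symm := by
    rw [Path.subpath_zero_one]
    rfl
  rw [e]
  exact aux _ _ _ h

variable {B : Type*} [TopologicalSpace B]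

/-- A map with a section is an isomorphism on fundamental groups if its points can be joined
naturally, inside the fibres, to the image of the section. -/
theorem bijective_mapOfEq_of_natural (μ : C(X, B)) (ζ : C(B, X)) (hζ : ∀ b, μ (ζ b) = b)
    (c : ∀ x, Path (ζ (μ x)) x) (hc : ∀ x t, μ (c x t) = μ x)
    (hnat : ∀ {x y : X} (γ : Path x y),
      (mk (c x)).trans (mk γ) = (mk (γ.map (ζ.comp μ).continuous)).trans (mk (c y)))
    {x₀ : X} {b : B} (h : μ x₀ = b) :
    Function.Bijective (FundamentalGroup.mapOfEq μ h) := by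
  subst h
  constructor
  · rw [injective_iff_map_eq_one]
    intro p hp
    obtain ⟨γ, rfl⟩ := Path.Homotopic.Quotient.mk_surjective (x₀ := x₀) (x₁ := x₀) p
    rw [FundamentalGroup.mapOfEq_apply] at hp
    have h1 : (γ.map μ.continuous).Homotopic (Path.refl (μ x₀)) :=
      Path.Homotopic.Quotient.eq.1 hp
    have h2 : mk (γ.map (ζ.comp μ).continuous) = Path.Homotopic.Quotient.refl (ζ (μ x₀)) :=
      Path.Homotopic.Quotient.eq.2 (h1.map ζ)
    -- Naturality turns `γ` into its image under `ζ ∘ μ`, which is trivial; cancelling `c x₀` leaves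
    -- the trivial class.
    have h3 : (mk (c x₀)).trans (mk γ) = mk (c x₀) :=
      ((hnat γ).trans (congrArg (fun q => q.trans (mk (c x₀))) h2)).trans
        (Path.Homotopic.Quotient.refl_trans _)
    have h4 := congrArg (fun q => (mk (c x₀)).symm.trans q) h3
    simp only [← Path.Homotopic.Quotient.trans_assoc, Path.Homotopic.Quotient.symm_trans,
      Path.Homotopic.Quotient.refl_trans] at h4
    exact h4
  · intro p
    obtain ⟨β, rfl⟩ := Path.Homotopic.Quotient.mk_surjective (x₀ := μ x₀) (x₁ := μ x₀) p
    refine ⟨mk (((c x₀).symm.trans (β.map ζ.continuous)).trans (c x₀)), ?_⟩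
    rw [FundamentalGroup.mapOfEq_apply]
    have e : mk ((((c x₀).symm.trans (β.map ζ.continuous)).trans (c x₀)).map μ.continuous) =
        mk (((Path.refl (μ x₀)).trans β).trans (Path.refl (μ x₀))) := by
      congr 1
      ext t
      simp only [Path.map_coe, Function.comp, Path.trans_apply, Path.symm_apply, Path.refl_apply]
      split_ifs <;> simp [hc, hζ]
    rw [← Path.Homotopic.Quotient.mk_map, e]
    simp
end Homotopy

/-! ### Local polar coordinates on the complex plane. -/

/-- Every point of `ℂ` has a neighbourhood whose points have polar coordinates
`(|z|², θ)` in a convex set that is mapped to a given disc. -/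
theorem exists_polar_rectangle (z₀ : ℂ) {r : ℝ} (hr : 0 < r) :
    ∃ V ∈ 𝓝 z₀, ∃ R : Set (ℝ × ℝ), Convex ℝ R ∧
      (∀ q ∈ R, (Real.sqrt q.1 : ℂ) * (AddCircle.toCircle (q.2 : AddCircle (1 : ℝ)) : ℂ) ∈
        Metric.ball z₀ r) ∧
      ∀ z ∈ V, ∃ θ : ℝ, (‖z‖ ^ 2, θ) ∈ R ∧
        (‖z‖ : ℂ) * (AddCircle.toCircle (θ : AddCircle (1 : ℝ)) : ℂ) = z := by
  have harg : ∀ z : ℂ, ∃ θ : ℝ,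
      (‖z‖ : ℂ) * (AddCircle.toCircle (θ : AddCircle (1 : ℝ)) : ℂ) = z := fun z => by
    refine ⟨z.arg / (2 * Real.pi), ?_⟩
    conv_rhs => rw [← Complex.norm_mul_exp_arg_mul_I z]
    rw [AddCircle.toCircle_apply_mk, Circle.coe_exp]
    congr 3
    have := Real.pi_ne_zero
    push_cast
    field_simp
  rcases eq_or_ne z₀ 0 with rfl | h0
  -- Around 0 no angle can be preferred, so all are allowed. Negative first coordinates are harmless
  -- because `Real.sqrt` sends them to 0.
  · refine ⟨Metric.ball 0 r, Metric.ball_mem_nhds _ hr, Set.Iio (r ^ 2) ×ˢ Set.univ,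
      (convex_Iio _).prod convex_univ, ?_, ?_⟩
    · rintro ⟨ρ, θ⟩ ⟨hρ, -⟩
      simp only [Set.mem_Iio] at hρ
      rw [mem_ball_zero_iff, norm_mul, Circle.norm_coe, mul_one, Complex.norm_real,
        Real.norm_of_nonneg (Real.sqrt_nonneg _)]
      exact (Real.sqrt_lt' hr).2 hρ
    · intro z hz
      obtain ⟨θ, hθ⟩ := harg z
      refine ⟨θ, ⟨?_, trivial⟩, hθ⟩
      simp only [Set.mem_Iio]
      have : ‖z‖ < r := by simpa using hz
      exact pow_lt_pow_left₀ this (norm_nonneg _) two_ne_zero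
  · obtain ⟨θ₀, hθ₀⟩ := harg z₀
    let Φ : ℝ × ℝ → ℂ := fun q =>
      (Real.sqrt q.1 : ℂ) * (AddCircle.toCircle (q.2 : AddCircle (1 : ℝ)) : ℂ)
    have hΦ : Continuous Φ := by
      have : Continuous fun q : ℝ × ℝ => (AddCircle.toCircle (q.2 : AddCircle (1 : ℝ)) : ℂ) :=
        continuous_subtype_val.comp (AddCircle.continuous_toCircle.comp
          ((AddCircle.continuous_mk' 1).comp continuous_snd))
      exact (Complex.continuous_ofReal.comp (by fun_prop)).mul this
    have hΦ0 : Φ (‖z₀‖ ^ 2, θ₀) = z₀ := by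
      simp only [Φ]; rw [Real.sqrt_sq (norm_nonneg _), hθ₀]
    have h1 : Φ ⁻¹' Metric.ball z₀ r ∈ 𝓝 (‖z₀‖ ^ 2, θ₀) :=
      hΦ.continuousAt.preimage_mem_nhds (by rw [hΦ0]; exact Metric.ball_mem_nhds _ hr)
    obtain ⟨δ, hδ, hball⟩ := Metric.mem_nhds_iff.1 h1
    -- The angle is measured from z₀, so that `arg` is used only near 1, away from its branch cut.
    let ψ : ℂ → ℝ × ℝ := fun z => (‖z‖ ^ 2, (z / z₀).arg / (2 * Real.pi) + θ₀)
    have hψ : ContinuousAt ψ z₀ := by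
      have h2 : ContinuousAt (fun z : ℂ => (z / z₀).arg) z₀ :=
        ContinuousAt.comp (f := fun z : ℂ => z / z₀) (g := Complex.arg)
          (Complex.continuousAt_arg (by rw [div_self h0]; exact Complex.one_mem_slitPlane))
          (by fun_prop)
      exact ContinuousAt.prodMk (by fun_prop) ((h2.div_const _).add continuousAt_const)
    refine ⟨ψ ⁻¹' Metric.ball (‖z₀‖ ^ 2, θ₀) δ, hψ.preimage_mem_nhds ?_, _,
      convex_ball (‖z₀‖ ^ 2, θ₀) δ, fun q hq => hball hq, fun z hz => ⟨_, hz, ?_⟩⟩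
    · have : ψ z₀ = (‖z₀‖ ^ 2, θ₀) := by simp [ψ, div_self h0]
      rw [this]; exact Metric.ball_mem_nhds _ hδ
    · have h3 : z = z / z₀ * z₀ := by field_simp
      have h4 := Complex.norm_mul_exp_arg_mul_I (z / z₀)
      rw [AddCircle.coe_add, AddCircle.toCircle_add, Circle.coe_mul,
        AddCircle.toCircle_apply_mk (_ / _), Circle.coe_exp]
      have h5 : (‖z₀‖ : ℂ) ≠ 0 := by exact_mod_cast norm_ne_zero_iff.2 h0
      have h6 : 2 * Real.pi / 1 * ((z / z₀).arg / (2 * Real.pi)) = (z / z₀).arg := by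
        field_simp
      have h7 : (‖z‖ : ℂ) = ‖z / z₀‖ * ‖z₀‖ := by
        rw [norm_div]
        push_cast
        field_simp
      rw [h6, h7]
      conv_rhs => rw [h3, ← h4]
      nth_rewrite 6 [← hθ₀]
      ring

/-! ### Invariance of corner points. -/

/-- A diffeomorphism of open sets of manifolds with corners sends corner points to the vertex. -/
theorem IsCornerPoint.apply_eq_zero {n : ℕ} {B : Type*} [TopologicalSpace B]
    [ChartedSpace (EuclideanQuadrant n) B] [IsManifold (IQ n) ∞ B]
    (φ : PartialDiffeomorph (IQ n) (IQ n) B (EuclideanQuadrant n) ∞) {b : B}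
    (hb : b ∈ φ.source) (hcorner : IsCornerPoint n b) (i : Fin n) : (φ b).1 i = 0 := by
  have hchart : ∀ j, (chartAt (EuclideanQuadrant n) b b).1 j = 0 := by
    have h1 : cornerIndex n b = n := by simpa [IsCornerPoint, stratum] using hcorner
    have h2 : {i : Fin n | (chartAt (EuclideanQuadrant n) b b).1 i = 0} = Set.univ :=
      Set.eq_of_subset_of_ncard_le (Set.subset_univ _)
        (by rw [Set.ncard_univ, Nat.card_fin]; exact h1.ge)
    exact fun j => (Set.ext_iff.1 h2 j).2 trivial
  by_contra hne
  have hpos : 0 < (φ b).1 i := lt_of_le_of_ne ((φ b).2 i) (Ne.symm hne)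
  let v : EuclideanSpace ℝ (Fin n) := EuclideanSpace.single i 1
  let κ := extChartAt (IQ n) b
  let g : EuclideanSpace ℝ (Fin n) → EuclideanSpace ℝ (Fin n) :=
    fun ξ => κ (φ.invFun ((IQ n).symm ξ))
  have hφb : φ b ∈ φ.target := φ.map_source hb
  have hinv : φ.invFun (φ b) = b := φ.left_inv hb
  have hsymm : ∀ ξ : EuclideanQuadrant n, (IQ n).symm ξ.1 = ξ := fun ξ => (IQ n).left_inv ξ
  have hg : DifferentiableWithinAt ℝ g (Set.range (IQ n)) (φ b).1 := by
    have h1 : MDifferentiableAt (IQ n) (IQ n) φ.invFun (φ b) :=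
      (φ.contMDiffOn_invFun.contMDiffAt (φ.open_target.mem_nhds hφb)).mdifferentiableAt (by simp)
    have h2 := ((mdifferentiableAt_iff _ _).1 h1).2
    rw [writtenInExtChartAt, hinv] at h2
    exact h2
  have hf : DifferentiableWithinAt ℝ (fun ξ => (φ (κ.symm ξ)).1) (Set.range (IQ n)) (κ b) := by
    have h1 : MDifferentiableAt (IQ n) (IQ n) φ b := φ.mdifferentiableAt (by simp) hb
    have h2 := ((mdifferentiableAt_iff _ _).1 h1).2
    exact h2
  have hgb : g (φ b).1 = κ b := by simp only [g, hsymm, hinv]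
  -- A positive i-th coordinate leaves room for a short segment through `φ b` in both directions.
  -- Seen in the chart at b, its coordinates are nonnegative and vanish at time 0, so each has a
  -- minimum there and the velocity is 0. Mapping back by `φ` would force `v = 0`.
  let c : ℝ → EuclideanSpace ℝ (Fin n) := fun t => (φ b).1 + t • v
  have hc0 : c 0 = (φ b).1 := by simp [c]
  have hc : HasDerivAt c v 0 := by
    have h := ((hasDerivAt_id (0 : ℝ)).smul_const v).const_add (φ b).1
    rw [one_smul] at h
    exact h
  have hcc : ContinuousAt c 0 := hc.continuousAt
  have hrange : ∀ ξ : EuclideanSpace ℝ (Fin n), ξ ∈ Set.range (IQ n) ↔ ∀ j, 0 ≤ ξ j := by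
    intro ξ
    change ξ ∈ Set.range (Subtype.val : EuclideanQuadrant n → _) ↔ _
    rw [range_euclideanQuadrant]
    rfl
  have hev : ∀ᶠ t in 𝓝 (0 : ℝ), c t ∈ Set.range (IQ n) := by
    filter_upwards [Ioi_mem_nhds (neg_lt_zero.2 hpos)] with t ht
    rw [hrange]
    intro j
    by_cases hj : j = i
    · subst hj
      have : -(φ b).1 j < t := ht
      simp [c, v]
      linarith
    · simpa [c, v, hj] using (φ b).2 j
  let S : Set ℝ := {t | c t ∈ Set.range (IQ n)}
  have hS : S ∈ 𝓝 (0 : ℝ) := hev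
  have hh : HasDerivAt (fun t => g (c t)) (fderivWithin ℝ g (Set.range (IQ n)) (φ b).1 v) 0 := by
    refine HasDerivWithinAt.hasDerivAt ?_ hS
    have h1 := hg.hasFDerivWithinAt
    rw [← hc0] at h1
    have h2 := h1.comp_hasDerivWithinAt (0 : ℝ) (hc.hasDerivWithinAt (s := S)) (fun t ht => ht)
    rw [hc0] at h2
    exact h2
  have hgr : ∀ ξ, g ξ ∈ Set.range (IQ n) := fun ξ => by
    simp only [g, κ, extChartAt_coe]
    exact ⟨_, rfl⟩
  have hd : fderivWithin ℝ g (Set.range (IQ n)) (φ b).1 v = 0 := by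
    ext j
    have h1 : HasDerivAt (fun t => g (c t) j)
        (fderivWithin ℝ g (Set.range (IQ n)) (φ b).1 v j) 0 :=
      (EuclideanSpace.proj (𝕜 := ℝ) j).hasFDerivAt.comp_hasDerivAt 0 hh
    have h2 : IsLocalMin (fun t => g (c t) j) 0 := by
      refine Filter.Eventually.of_forall fun t => ?_
      have h3 : g (c 0) j = 0 := by
        rw [hc0, hgb]
        exact hchart j
      simp only [h3]
      exact (hrange _).1 (hgr _) j
    exact h2.hasDerivAt_eq_zero h1
  rw [hd] at hh
  have hfh : HasDerivAt (fun t => (φ (κ.symm (g (c t)))).1) 0 0 := by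
    have h1 : HasFDerivWithinAt (fun ξ => (φ (κ.symm ξ)).1)
        (fderivWithin ℝ (fun ξ => (φ (κ.symm ξ)).1) (Set.range (IQ n)) (κ b))
        (Set.range (IQ n)) (g (c 0)) := by
      rw [hc0, hgb]
      exact hf.hasFDerivWithinAt
    have h2 := h1.comp_hasDerivWithinAt (0 : ℝ) (hh.hasDerivWithinAt (s := Set.univ))
      (fun t _ => hgr (c t))
    simpa [Function.comp_def] using h2
  have heq : (fun t => (φ (κ.symm (g (c t)))).1) =ᶠ[𝓝 0] c := by
    have hcs : Filter.Tendsto (fun t => (IQ n).symm (c t)) (𝓝 0) (𝓝 (φ b)) := by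
      have := (IQ n).continuous_symm.continuousAt.comp hcc
      rwa [ContinuousAt, Function.comp, hc0, hsymm] at this
    have hct : Filter.Tendsto (fun t => φ.invFun ((IQ n).symm (c t))) (𝓝 0) (𝓝 b) := by
      have h1 : ContinuousAt φ.invFun (φ b) :=
        φ.contMDiffOn_invFun.continuousOn.continuousAt (φ.open_target.mem_nhds hφb)
      have h2 := h1.tendsto.comp hcs
      rwa [hinv] at h2
    filter_upwards [hev, hcs (φ.open_target.mem_nhds hφb),
      hct ((chartAt (EuclideanQuadrant n) b).open_source.mem_nhds (mem_chart_source _ b))]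
      with t h1 h2 h3
    have h4 : κ.symm (g (c t)) = φ.invFun ((IQ n).symm (c t)) :=
      κ.left_inv (by rw [extChartAt_source]; exact h3)
    rw [h4]
    have h5 : φ (φ.invFun ((IQ n).symm (c t))) = (IQ n).symm (c t) := φ.right_inv h2
    rw [h5]
    exact (IQ n).right_inv h1
  have hv : v = 0 := hc.unique (hfh.congr_of_eventuallyEq heq.symm)
  have : v i = 0 := by rw [hv]; rfl
  simp [v] at this

/-! ### Torus coordinates and their lifts to real vectors. -/

section Torus

variable {n : ℕ}

/-- The quotient map `ℝ^n → T^n`. -/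
def torusMk (w : Fin n → ℝ) : Torus n := fun i => (w i : AddCircle (1 : ℝ))

theorem continuous_torusMk : Continuous (torusMk (n := n)) :=
  continuous_pi fun i => (AddCircle.continuous_mk' 1).comp (continuous_apply i)

theorem torusMk_surjective : Function.Surjective (torusMk (n := n)) := fun θ => by
  choose w hw using fun i => QuotientAddGroup.mk_surjective (θ i)
  exact ⟨w, funext hw⟩

theorem torusMk_zero : torusMk (0 : Fin n → ℝ) = 0 := rfl

/-- The linear action of `SL_n(ℤ)` on `ℝ^n`. -/
def realAct (g : SLZ n) (w : Fin n → ℝ) : Fin n → ℝ := fun i => ∑ j, (g.1 i j) • w j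

theorem torusAct_torusMk (g : SLZ n) (w : Fin n → ℝ) :
    torusAct g (torusMk w) = torusMk (realAct g w) := by
  funext i
  have h := map_sum (QuotientAddGroup.mk' (AddSubgroup.zmultiples (1 : ℝ)))
    (fun j => (g.1 i j) • w j) Finset.univ
  simp only [map_zsmul] at h
  exact h.symm

theorem realAct_smul (g : SLZ n) (t : ℝ) (w : Fin n → ℝ) :
    realAct g (t • w) = t • realAct g w := by
  funext i
  simp only [realAct, Pi.smul_apply, Finset.smul_sum]
  exact Finset.sum_congr rfl fun j _ => smul_comm _ _ _

theorem realAct_intCast (g : SLZ n) (v : Fin n → ℤ) :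
    realAct g (fun i => (v i : ℝ)) = fun i => ((∑ j, g.1 i j * v j : ℤ) : ℝ) := by
  funext i
  simp [realAct]

theorem realAct_zero (g : SLZ n) : realAct g 0 = 0 := by
  funext i
  simp [realAct]

/-- The map `ν_{ℂ^n}` in real coordinates. -/
def polar (ξ : EuclideanSpace ℝ (Fin n)) (w : Fin n → ℝ) : CSpace n :=
  WithLp.toLp 2 fun i => (Real.sqrt (ξ i) : ℂ) * (AddCircle.toCircle (torusMk w i) : ℂ)

theorem continuous_polar :
    Continuous fun q : EuclideanSpace ℝ (Fin n) × (Fin n → ℝ) => polar q.1 q.2 := by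
  refine (PiLp.continuous_toLp 2 _).comp (continuous_pi fun i => ?_)
  refine (Complex.continuous_ofReal.comp (by fun_prop)).mul ?_
  exact continuous_subtype_val.comp (AddCircle.continuous_toCircle.comp
    ((continuous_apply i).comp (continuous_torusMk.comp continuous_snd)))

theorem momentC_polar {ξ : EuclideanSpace ℝ (Fin n)} (hξ : ∀ i, 0 ≤ ξ i) (w : Fin n → ℝ) :
    momentC (polar ξ w) = ξ := by
  ext i
  change ‖(Real.sqrt (ξ i) : ℂ) * (AddCircle.toCircle (torusMk w i) : ℂ)‖ ^ 2 = ξ i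
  rw [norm_mul, Circle.norm_coe, mul_one, Complex.norm_real,
    Real.norm_of_nonneg (Real.sqrt_nonneg _), Real.sq_sqrt (hξ i)]

/-- The circle in a coordinate is collapsed exactly where `ξ i = 0`; elsewhere the angle is
determined modulo 1. -/
theorem polar_eq_polar_iff {ξ : EuclideanSpace ℝ (Fin n)} (hξ : ∀ i, 0 ≤ ξ i)
    {w w' : Fin n → ℝ} :
    polar ξ w = polar ξ w' ↔ ∀ i, ξ i = 0 ∨ ∃ k : ℤ, w' i = w i + k := by
  have key : ∀ a b : ℝ, ((a : AddCircle (1 : ℝ)) = b) ↔ ∃ k : ℤ, b = a + k := fun a b => by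
    rw [eq_comm, ← sub_eq_zero, ← AddCircle.coe_sub, AddCircle.coe_eq_zero_iff]
    refine exists_congr fun k => ?_
    rw [zsmul_one]
    constructor <;> intro h <;> linarith
  have h1 : polar ξ w = polar ξ w' ↔ ∀ i, (polar ξ w) i = (polar ξ w') i :=
    ⟨fun h i => by rw [h], fun h => by ext i; exact h i⟩
  rw [h1]
  refine forall_congr' fun i => ?_
  change (Real.sqrt (ξ i) : ℂ) * (AddCircle.toCircle (torusMk w i) : ℂ) =
    (Real.sqrt (ξ i) : ℂ) * (AddCircle.toCircle (torusMk w' i) : ℂ) ↔ _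
  rw [mul_eq_mul_left_iff, ← key, or_comm, Complex.ofReal_eq_zero, Real.sqrt_eq_zero (hξ i),
    Circle.coe_inj, (AddCircle.injective_toCircle one_ne_zero).eq_iff]
  rfl

end Torus

variable {n : ℕ} {B X P : Type*}
  [TopologicalSpace B] [ChartedSpace (EuclideanQuadrant n) B]
  [TopologicalSpace X] [ChartedSpace (EuclideanSpace ℝ (Fin (2 * n))) X]
  [TopologicalSpace P] [MulAction (SLZ n)ᵐᵒᵖ P]
  {πP : P → B} {hP : IsPrincipalSLBundle n πP} {ν : TorusBundle n P → X} {μ : X → B}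

/-! ### Locally toric charts in polar coordinates. -/

namespace LocallyToricChart

variable {b₀ : B} (e : LocallyToricChart n πP ν μ b₀)

/-- The inverse of a locally toric chart in polar coordinates. -/
def toX (ξ : EuclideanSpace ℝ (Fin n)) (w : Fin n → ℝ) : X := e.φX.invFun (polar ξ w)

/-- The image of a locally toric chart in `ℝ^n`. -/
def disc : Set (EuclideanSpace ℝ (Fin n)) := {ξ | ∀ i, 0 ≤ ξ i} ∩ Metric.ball (e.φB b₀).1 e.ε

theorem convex_disc : Convex ℝ e.disc :=
  EuclideanQuadrant.convex.inter (convex_ball _ _)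

theorem polar_mem_target {ξ : EuclideanSpace ℝ (Fin n)} (hξ : ξ ∈ e.disc) (w : Fin n → ℝ) :
    polar ξ w ∈ e.φX.target := by
  rw [e.target_φX, Set.mem_ofPred_eq, momentC_polar hξ.1]
  exact hξ.2

theorem continuousOn_toX :
    ContinuousOn (fun q : EuclideanSpace ℝ (Fin n) × (Fin n → ℝ) => e.toX q.1 q.2)
      (e.disc ×ˢ Set.univ) :=
  e.φX.contMDiffOn_invFun.continuousOn.comp continuous_polar.continuousOn
    fun q hq => e.polar_mem_target hq.1 q.2

theorem continuous_toX_comp {Z : Type*} [TopologicalSpace Z] {ξ : Z → EuclideanSpace ℝ (Fin n)}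
    {w : Z → Fin n → ℝ} (hξ : Continuous ξ) (hw : Continuous w) (h : ∀ z, ξ z ∈ e.disc) :
    Continuous fun z => e.toX (ξ z) (w z) :=
  e.continuousOn_toX.comp_continuous (hξ.prodMk hw) fun z => ⟨h z, trivial⟩

theorem φB_mem_disc {b : B} (hb : b ∈ e.φB.source) : (e.φB b).1 ∈ e.disc := by
  refine ⟨(e.φB b).2, ?_⟩
  have : e.φB b ∈ e.φB.target := e.φB.map_source hb
  rwa [e.target_φB] at this

theorem toX_congr {ξ : EuclideanSpace ℝ (Fin n)} (hξ : ξ ∈ e.disc) {w w' : Fin n → ℝ}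
    (h : ∀ i, ξ i = 0 ∨ ∃ k : ℤ, w' i = w i + k) : e.toX ξ w = e.toX ξ w' := by
  rw [toX, (polar_eq_polar_iff hξ.1).2 h, toX]

theorem eq_zero_or_of_toX_eq {ξ : EuclideanSpace ℝ (Fin n)} (hξ : ξ ∈ e.disc) {w w' : Fin n → ℝ}
    (h : e.toX ξ w = e.toX ξ w') : ∀ i, ξ i = 0 ∨ ∃ k : ℤ, w' i = w i + k :=
  (polar_eq_polar_iff hξ.1).1
    (e.φX.symm.injOn (e.polar_mem_target hξ w) (e.polar_mem_target hξ w') h)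

theorem nu_mk (hX : IsTwistedToricManifold n hP ν μ) (p : P) (hp : πP p ∈ e.φB.source)
    (w : Fin n → ℝ) :
    ν (TorusBundle.mk p (torusMk w)) = e.toX (e.φB (πP p)).1 (realAct (e.φP p).2 w) := by
  have h1 : ν (TorusBundle.mk p (torusMk w)) ∈ e.φX.source := by
    rw [e.source_φX, Set.mem_preimage, hX.proj_comm]
    exact hp
  rw [← e.φX.left_inv h1]
  change e.φX.invFun (e.φX (ν _)) = _
  rw [e.torus_comm p _ hp, torusAct_torusMk]
  rfl

/-- Take the point of P that the trivialization sends to the identity matrix: its torus coordinates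
are those of the chart. -/
theorem exists_frame (hX : IsTwistedToricManifold n hP ν μ) {b : B} (hb : b ∈ e.φB.source) :
    ∃ p : P, πP p = b ∧
      ∀ w, ν (TorusBundle.mk p (torusMk w)) = e.toX (e.φB b).1 w := by
  have hb' : b ∈ e.φP.baseSet := by rwa [e.baseSet_φP]
  have h1 := e.φP.proj_symm_apply' (x := (1 : SLZ n)) hb'
  have h2 := e.φP.apply_symm_apply' (x := (1 : SLZ n)) hb'
  refine ⟨_, h1, fun w => ?_⟩
  rw [e.nu_mk hX _ (by rwa [h1]), h1, h2]
  congr 1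
  funext i
  simp [realAct, Matrix.one_apply, ite_smul]

end LocallyToricChart

/-! ### The zero section. -/

namespace IsTwistedToricManifold

theorem exists_mk_eq (hX : IsTwistedToricManifold n hP ν μ) (x : X) :
    ∃ (p : P) (w : Fin n → ℝ), πP p = μ x ∧ ν (TorusBundle.mk p (torusMk w)) = x := by
  obtain ⟨y, rfl⟩ := hX.surjective_ν x
  obtain ⟨⟨p, θ⟩, rfl⟩ := Quotient.exists_rep y
  obtain ⟨w, rfl⟩ := torusMk_surjective θ
  exact ⟨p, w, (hX.proj_comm (TorusBundle.mk p (torusMk w))).symm, rfl⟩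

theorem exists_point (hX : IsTwistedToricManifold n hP ν μ) (b : B) : ∃ p : P, πP p = b := by
  obtain ⟨x, rfl⟩ := hX.surjective_μ b
  obtain ⟨p, -, hp, -⟩ := hX.exists_mk_eq x
  exact ⟨p, hp⟩

/-- The section of `μ` induced by the zero section of the torus bundle. -/
def zeroSection (hX : IsTwistedToricManifold n hP ν μ) (b : B) : X :=
  ν (TorusBundle.mk (hX.exists_point b).choose 0)

/-- Matrices fix 0, so the point of P chosen over b does not matter. -/
theorem zeroSection_eq_toX (hX : IsTwistedToricManifold n hP ν μ) {b₀ : B}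
    (e : LocallyToricChart n πP ν μ b₀) {b : B} (hb : b ∈ e.φB.source) :
    hX.zeroSection b = e.toX (e.φB b).1 0 := by
  have h := (hX.exists_point b).choose_spec
  rw [zeroSection, ← torusMk_zero, e.nu_mk hX _ (by rwa [h]), h, realAct_zero]

theorem zeroSection_proj (hX : IsTwistedToricManifold n hP ν μ) (p : P) :
    hX.zeroSection (πP p) = ν (TorusBundle.mk p (torusMk 0)) := by
  obtain ⟨e⟩ := hX.exists_chart (πP p)
  rw [hX.zeroSection_eq_toX e e.mem_source, e.nu_mk hX _ e.mem_source, realAct_zero]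

theorem μ_zeroSection (hX : IsTwistedToricManifold n hP ν μ) (b : B) :
    μ (hX.zeroSection b) = b := by
  obtain ⟨p, rfl⟩ := hX.exists_point b
  rw [zeroSection_proj, hX.proj_comm]
  rfl

theorem continuous_zeroSection (hX : IsTwistedToricManifold n hP ν μ) :
    Continuous hX.zeroSection := by
  rw [continuous_iff_continuousAt]
  intro b
  obtain ⟨e⟩ := hX.exists_chart b
  have h1 : ContinuousOn (fun b => e.toX (e.φB b).1 0) e.φB.source :=
    e.continuousOn_toX.comp
      ((continuous_subtype_val.comp_continuousOn e.φB.contMDiffOn_toFun.continuousOn).prodMk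
        continuousOn_const) fun b hb => ⟨e.φB_mem_disc hb, trivial⟩
  have h2 : ContinuousOn hX.zeroSection e.φB.source :=
    h1.congr fun b hb => hX.zeroSection_eq_toX e hb
  exact h2.continuousAt (e.φB.open_source.mem_nhds e.mem_source)

/-! ### Triviality of the integral torus loops. -/

/-- All the loops `t ↦ ν [p, t v]` at the zero section over `b`, with `v ∈ ℤ^n`, are
null-homotopic. -/
def TorusLoopsTrivial (hX : IsTwistedToricManifold n hP ν μ) (b : B) : Prop :=
  ∀ (l : Path (hX.zeroSection b) (hX.zeroSection b)) (p : P) (v : Fin n → ℤ), πP p = b →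
    (∀ t, l t = ν (TorusBundle.mk p (torusMk ((t : ℝ) • fun i => (v i : ℝ))))) →
    l.Homotopic (Path.refl _)

/-- The loops with a fixed integral direction over a segment in the convex disc form an annulus.
Hence the loops at its two ends are conjugate by the path `m` in the zero section. -/
theorem TorusLoopsTrivial.of_chart {hX : IsTwistedToricManifold n hP ν μ} {b₀ b b' : B}
    (e : LocallyToricChart n πP ν μ b₀) (hb : b ∈ e.φB.source) (hb' : b' ∈ e.φB.source)
    (h : hX.TorusLoopsTrivial b) : hX.TorusLoopsTrivial b' := by
  rintro l' p' v' rfl hl'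
  obtain ⟨p, hp, hpw⟩ := e.exists_frame hX hb
  -- Changes of frame are integral matrices, so the direction stays integral in the chart.
  obtain ⟨v, hv⟩ : ∃ v : Fin n → ℤ,
      realAct (e.φP p').2 (fun i => (v' i : ℝ)) = fun i => (v i : ℝ) :=
    ⟨_, realAct_intCast _ _⟩
  set u : Fin n → ℝ := fun i => (v i : ℝ)
  have hl'' : ∀ t : I, l' t = e.toX (e.φB (πP p')).1 ((t : ℝ) • u) := fun t => by
    rw [hl', e.nu_mk hX _ hb', realAct_smul, hv]
  have hs := hX.zeroSection_eq_toX e hb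
  have hs' := hX.zeroSection_eq_toX e hb'
  have hd := e.φB_mem_disc hb
  have hd' := e.φB_mem_disc hb'
  set ξ := (e.φB b).1
  set ξ' := (e.φB (πP p')).1
  let F : C(I × I, X) := ⟨fun z => e.toX ((1 - (z.1 : ℝ)) • ξ + (z.1 : ℝ) • ξ') ((z.2 : ℝ) • u),
    e.continuous_toX_comp (by fun_prop) (by fun_prop) fun z =>
      e.convex_disc hd hd' (by linarith [z.1.2.2]) z.1.2.1 (by ring)⟩
  have h1 : ∀ s, F (s, 1) = F (s, 0) := fun s => by
    refine (e.toX_congr (e.convex_disc hd hd' (by linarith [s.2.2]) s.2.1 (by ring)) ?_).symm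
    exact fun i => Or.inr ⟨v i, by simp [u]⟩
  let l : Path (hX.zeroSection b) (hX.zeroSection b) :=
    ⟨⟨fun t => F (0, t), by fun_prop⟩, by simp [F, hs], by
      change F (0, 1) = _; rw [h1]; simp [F, hs]⟩
  let m : Path (hX.zeroSection b) (hX.zeroSection (πP p')) :=
    ⟨⟨fun t => F (t, 0), by fun_prop⟩, by simp [F, hs], by simp [F, hs']⟩
  have hl : l.Homotopic (Path.refl _) := h l p v hp fun t => by
    rw [hpw]
    simp [l, F, u, ξ]
  have hsq : (l.trans m).Homotopic (m.trans l') :=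
    homotopic_of_square F (fun _ => rfl) (fun s => (h1 s).symm) (fun _ => rfl)
      (fun t => by rw [hl'']; simp [F])
  have h2 := Path.Homotopic.Quotient.eq.2 hsq
  rw [Path.Homotopic.Quotient.mk_trans, Path.Homotopic.Quotient.mk_trans,
    Path.Homotopic.Quotient.eq.2 hl] at h2
  have h3 := congrArg (fun q => (Path.Homotopic.Quotient.mk m).symm.trans q) h2
  simp only [← Path.Homotopic.Quotient.trans_assoc, Path.Homotopic.Quotient.symm_trans,
    Path.Homotopic.Quotient.refl_trans, Path.Homotopic.Quotient.mk_refl] at h3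
  exact Path.Homotopic.Quotient.eq.1 h3.symm

/-- All coordinates vanish at the vertex, so the loop is constant. -/
theorem TorusLoopsTrivial.of_isCornerPoint [IsManifold (IQ n) ∞ B]
    (hX : IsTwistedToricManifold n hP ν μ) {b : B} (hb : IsCornerPoint n b) :
    hX.TorusLoopsTrivial b := by
  rintro l p v rfl hl
  obtain ⟨e⟩ := hX.exists_chart (πP p)
  suffices l = Path.refl _ by rw [this]
  ext t
  rw [hl, e.nu_mk hX _ e.mem_source, Path.refl_apply, hX.zeroSection_eq_toX e e.mem_source]
  exact e.toX_congr (e.φB_mem_disc e.mem_source) fun i =>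
    Or.inl (hb.apply_eq_zero e.φB e.mem_source i)

theorem torusLoopsTrivial [IsManifold (IQ n) ∞ B] [PreconnectedSpace B]
    (hX : IsTwistedToricManifold n hP ν μ) (hcorner : ∃ b : B, IsCornerPoint n b) (b : B) :
    hX.TorusLoopsTrivial b := by
  -- The predicate `Q` treats the set (`id`) and its complement (`Not`) at once.
  have hopen : ∀ (Q : Prop → Prop), IsOpen {b | Q (hX.TorusLoopsTrivial b)} := fun Q => by
    rw [isOpen_iff_mem_nhds]
    intro b hb
    obtain ⟨e⟩ := hX.exists_chart b
    filter_upwards [e.φB.open_source.mem_nhds e.mem_source] with b' hb'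
    have : hX.TorusLoopsTrivial b' = hX.TorusLoopsTrivial b :=
      propext ⟨.of_chart e hb' e.mem_source, .of_chart e e.mem_source hb'⟩
    change Q (hX.TorusLoopsTrivial b')
    rwa [this]
  have hclopen : IsClopen {b | hX.TorusLoopsTrivial b} :=
    ⟨⟨hopen Not⟩, hopen id⟩
  obtain ⟨c, hc⟩ := hcorner
  have := hclopen.eq_univ ⟨c, .of_isCornerPoint hX hc⟩
  exact Set.eq_univ_iff_forall.1 this b

/-! ### Radial paths. -/

/-- The path `t ↦ ν [p, t w]` from the zero section to `x = ν [p, w]`. -/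
def IsRadial (hX : IsTwistedToricManifold n hP ν μ) {x : X}
    (c : Path (hX.zeroSection (μ x)) x) : Prop :=
  ∃ (p : P) (w : Fin n → ℝ), πP p = μ x ∧
    ∀ t, c t = ν (TorusBundle.mk p (torusMk ((t : ℝ) • w)))

theorem exists_isRadial (hX : IsTwistedToricManifold n hP ν μ) (x : X) :
    ∃ c : Path (hX.zeroSection (μ x)) x, hX.IsRadial c := by
  obtain ⟨p, w, hp, hx⟩ := hX.exists_mk_eq x
  have hmk : Continuous fun θ : Torus n => TorusBundle.mk p θ :=
    continuous_quotient_mk'.comp (by fun_prop : Continuous fun θ : Torus n => (p, θ))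
  refine ⟨⟨⟨fun t => ν (TorusBundle.mk p (torusMk ((t : ℝ) • w))), ?_⟩, ?_, ?_⟩, p, w, hp,
    fun t => rfl⟩
  · exact hX.continuous_ν.comp (hmk.comp (continuous_torusMk.comp (by fun_prop)))
  · simp [← hp, hX.zeroSection_proj]
  · simp [hx]

theorem IsRadial.μ_apply {hX : IsTwistedToricManifold n hP ν μ} {x : X}
    {c : Path (hX.zeroSection (μ x)) x} (hc : hX.IsRadial c) (t : I) : μ (c t) = μ x := by
  obtain ⟨p, w, hp, h⟩ := hc
  rw [h, hX.proj_comm, ← hp]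
  rfl

theorem IsRadial.exists_eq_toX {hX : IsTwistedToricManifold n hP ν μ} {x : X}
    {c : Path (hX.zeroSection (μ x)) x} (hc : hX.IsRadial c) {b₀ : B}
    (e : LocallyToricChart n πP ν μ b₀) (hb : μ x ∈ e.φB.source) :
    ∃ w : Fin n → ℝ, ∀ t : I, c t = e.toX (e.φB (μ x)).1 ((t : ℝ) • w) := by
  obtain ⟨p, w, hp, h⟩ := hc
  refine ⟨realAct (e.φP p).2 w, fun t => ?_⟩
  rw [h, e.nu_mk hX _ (by rwa [hp]), hp, realAct_smul]

/-- Radial paths with the same end point are homotopic. -/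
theorem IsRadial.homotopic {hX : IsTwistedToricManifold n hP ν μ} {x : X}
    (htriv : hX.TorusLoopsTrivial (μ x))
    {c c' : Path (hX.zeroSection (μ x)) x} (hc : hX.IsRadial c) (hc' : hX.IsRadial c') :
    c.Homotopic c' := by
  obtain ⟨e⟩ := hX.exists_chart (μ x)
  obtain ⟨w, hw⟩ := hc.exists_eq_toX e e.mem_source
  obtain ⟨w', hw'⟩ := hc'.exists_eq_toX e e.mem_source
  obtain ⟨p, hp, hpw⟩ := e.exists_frame hX e.mem_source
  have hd := e.φB_mem_disc e.mem_source
  have hs := hX.zeroSection_eq_toX e e.mem_source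
  set ξ := (e.φB (μ x)).1
  have hx : e.toX ξ w = x := by simpa using (hw 1).symm
  have hx' : e.toX ξ w' = x := by simpa using (hw' 1).symm
  -- Where `ξ i = 0` the angles are unrelated, and the integer is set to 0.
  have hk : ∀ i, ∃ k : ℤ, ξ i = 0 ∨ w' i = w i + k := fun i => by
    rcases e.eq_zero_or_of_toX_eq hd (hx.trans hx'.symm) i with h | ⟨k, h⟩
    exacts [⟨0, .inl h⟩, ⟨k, .inr h⟩]
  choose v hv using hk
  set u : Fin n → ℝ := fun i => (v i : ℝ)
  have hF : ∀ f : I × I → Fin n → ℝ, Continuous f → Continuous fun z => e.toX ξ (f z) :=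
    fun f hf => e.continuous_toX_comp continuous_const hf fun _ => hd
  -- Both squares have left side `c` and top `m`, a loop at x. `F` has bottom `l` and right side
  -- `c`; `G` has constant bottom and right side `c'`, as `w + u` and `w'` give the same points over
  -- `ξ`. Hence `l · c` is homotopic to `c'`, and `l` is trivial.
  let F : C(I × I, X) :=
    ⟨fun z => e.toX ξ ((z.1 : ℝ) • u + (z.2 : ℝ) • w), hF _ (by fun_prop)⟩
  let G : C(I × I, X) :=
    ⟨fun z => e.toX ξ ((z.2 : ℝ) • (w + (z.1 : ℝ) • u)), hF _ (by fun_prop)⟩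
  let l : Path (hX.zeroSection (μ x)) (hX.zeroSection (μ x)) :=
    ⟨⟨fun s => F (s, 0), by fun_prop⟩, by simp [F, hs], by
      rw [hs]
      exact (e.toX_congr hd fun i => Or.inr ⟨v i, by simp [u]⟩).symm⟩
  let m : Path x x :=
    ⟨⟨fun s => F (s, 1), by fun_prop⟩, by simp [F, hx], by
      refine Eq.trans ?_ hx
      exact (e.toX_congr hd fun i => Or.inr ⟨v i, by simp [u, add_comm]⟩).symm⟩
  have hl : l.Homotopic (Path.refl _) := htriv l p v hp fun t => by
    rw [hpw]
    simp [l, F, u]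
  have h1 : (c.trans m).Homotopic (l.trans c) :=
    homotopic_of_square F (fun t => by rw [hw]; simp [F]) (fun _ => rfl) (fun _ => rfl)
      (fun t => by
        rw [hw]
        exact e.toX_congr hd fun i => Or.inr ⟨v i, by simp [u, add_comm]⟩)
  have h2 : (c.trans m).Homotopic ((Path.refl _).trans c') :=
    homotopic_of_square G (fun t => by rw [hw]; simp [G])
      (fun s => by simp [m, F, G, add_comm]) (fun s => by simp [G, hs])
      (fun t => by
        rw [hw']
        exact e.toX_congr hd fun i => by
          rcases hv i with h | h
          · exact .inl h
          · exact .inr ⟨0, by simp [u, h]⟩)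
  have h1' := Path.Homotopic.Quotient.eq.2 h1
  have h2' := Path.Homotopic.Quotient.eq.2 h2
  rw [h1', Path.Homotopic.Quotient.mk_trans, Path.Homotopic.Quotient.eq.2 hl,
    Path.Homotopic.Quotient.mk_trans, Path.Homotopic.Quotient.mk_refl,
    Path.Homotopic.Quotient.refl_trans, Path.Homotopic.Quotient.refl_trans] at h2'
  exact Path.Homotopic.Quotient.eq.1 h2'

/-- Radial paths are natural for short paths. -/
theorem exists_nhds_natural (hX : IsTwistedToricManifold n hP ν μ)
    (x₀ : X) : ∃ V ∈ 𝓝 x₀, ∀ (x y : X) (γ : Path x y), (∀ t, γ t ∈ V) →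
      ∃ (c : Path (hX.zeroSection (μ x)) x) (c' : Path (hX.zeroSection (μ y)) y),
        hX.IsRadial c ∧ hX.IsRadial c' ∧ (c.trans γ).Homotopic
          ((γ.map (hX.continuous_zeroSection.comp hX.continuous_μ)).trans c') := by
  obtain ⟨e⟩ := hX.exists_chart (μ x₀)
  have hx₀ : x₀ ∈ e.φX.source := by rw [e.source_φX]; exact e.mem_source
  have hopen : IsOpen ((WithLp.toLp 2 : (Fin n → ℂ) → CSpace n) ⁻¹' e.φX.target) :=
    e.φX.open_target.preimage (PiLp.continuous_toLp 2 _)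
  obtain ⟨r, hr, hball⟩ := Metric.isOpen_iff.1 hopen (WithLp.ofLp (e.φX x₀))
    (e.φX.map_source hx₀)
  -- Without the Euclidean norm, `Fin n → ℂ` has the sup metric, whose balls are products of discs,
  -- so each coordinate can be treated separately.
  choose V hV R hRc hRball hVR using fun i => exists_polar_rectangle (e.φX x₀ i) hr
  have hcont : ContinuousOn e.φX e.φX.source := e.φX.contMDiffOn_toFun.continuousOn
  have hmom : ∀ x ∈ e.φX.source, ∀ i, (e.φB (μ x)).1 i = ‖e.φX x i‖ ^ 2 := fun x hx i => by
    rw [e.source_φX] at hx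
    rw [e.moment_comm x hx]
    rfl
  refine ⟨e.φX.source ∩ {x | ∀ i, e.φX x i ∈ V i}, Filter.inter_mem
    (e.φX.open_source.mem_nhds hx₀) (Filter.eventually_all.2 fun i => ?_), ?_⟩
  · have h1 : ContinuousAt (fun x => e.φX x i) x₀ :=
      ((EuclideanSpace.proj (𝕜 := ℂ) i).continuous.continuousAt).comp
        (hcont.continuousAt (e.φX.open_source.mem_nhds hx₀))
    exact h1 (hV i)
  intro x y γ hγ
  have hangle : ∀ z ∈ e.φX.source ∩ {x | ∀ i, e.φX x i ∈ V i}, ∃ w : Fin n → ℝ,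
      (∀ i, ((e.φB (μ z)).1 i, w i) ∈ R i) ∧ polar (e.φB (μ z)).1 w = e.φX z := by
    rintro z ⟨hz, hzV⟩
    choose w hw hw' using fun i => hVR i _ (hzV i)
    refine ⟨w, fun i => by rw [hmom z hz]; exact hw i, ?_⟩
    ext i
    rw [← hw' i]
    change (Real.sqrt ((e.φB (μ z)).1 i) : ℂ) * _ = _
    rw [hmom z hz, Real.sqrt_sq (norm_nonneg _)]
    rfl
  have hx := hγ 0
  have hy := hγ 1
  rw [γ.source] at hx
  rw [γ.target] at hy
  obtain ⟨w, hwR, hw⟩ := hangle x hx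
  obtain ⟨w', hwR', hw'⟩ := hangle y hy
  have hμ : ∀ z ∈ e.φX.source, μ z ∈ e.φB.source := fun z hz => by rwa [e.source_φX] at hz
  have hs := hX.zeroSection_eq_toX e (hμ x hx.1)
  have hs' := hX.zeroSection_eq_toX e (hμ y hy.1)
  have hd := e.φB_mem_disc (hμ x hx.1)
  have hd' := e.φB_mem_disc (hμ y hy.1)
  obtain ⟨p, hp, hpw⟩ := e.exists_frame hX (hμ x hx.1)
  obtain ⟨p', hp', hpw'⟩ := e.exists_frame hX (hμ y hy.1)
  have hξx : (e.φB (μ x)).1 = (e.φB (μ (γ 0))).1 := by rw [γ.source]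
  have hξy : (e.φB (μ y)).1 = (e.φB (μ (γ 1))).1 := by rw [γ.target]
  set ξ := (e.φB (μ x)).1
  set ξ' := (e.φB (μ y)).1
  have hwx : e.toX ξ w = x := by
    rw [LocallyToricChart.toX, hw]
    exact e.φX.left_inv hx.1
  have hwy : e.toX ξ' w' = y := by
    rw [LocallyToricChart.toX, hw']
    exact e.φX.left_inv hy.1
  let Ξ : I → EuclideanSpace ℝ (Fin n) := fun s => (1 - (s : ℝ)) • ξ + (s : ℝ) • ξ'
  let W : I → Fin n → ℝ := fun s => (1 - (s : ℝ)) • w + (s : ℝ) • w'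
  have hΞ : Continuous Ξ := by fun_prop
  have hW : Continuous W := by fun_prop
  have hΞd : ∀ s, Ξ s ∈ e.disc := fun s =>
    e.convex_disc hd hd' (by linarith [s.2.2]) s.2.1 (by ring)
  have hΞ0 : Ξ 0 = ξ := by simp [Ξ]
  have hΞ1 : Ξ 1 = ξ' := by simp [Ξ]
  have hW0 : W 0 = w := by simp [W]
  have hW1 : W 1 = w' := by simp [W]
  let F : C(I × I, X) := ⟨fun z => e.toX (Ξ z.1) ((z.2 : ℝ) • W z.1),
    e.continuous_toX_comp (by fun_prop) (by fun_prop) fun z => hΞd z.1⟩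
  let c : Path (hX.zeroSection (μ x)) x :=
    ⟨⟨fun t => F (0, t), by fun_prop⟩, by simp [F, hΞ0, hs], by simp [F, hΞ0, hW0, hwx]⟩
  let c' : Path (hX.zeroSection (μ y)) y :=
    ⟨⟨fun t => F (1, t), by fun_prop⟩, by simp [F, hΞ1, hs'], by simp [F, hΞ1, hW1, hwy]⟩
  let m : Path (hX.zeroSection (μ x)) (hX.zeroSection (μ y)) :=
    ⟨⟨fun s => F (s, 0), by fun_prop⟩, by simp [F, hΞ0, hs], by simp [F, hΞ1, hs']⟩
  let η : Path x y :=
    ⟨⟨fun s => F (s, 1), by fun_prop⟩, by simp [F, hΞ0, hW0, hwx], by simp [F, hΞ1, hW1, hwy]⟩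
  -- `η` is straight in polar coordinates and `γ` is arbitrary, but convexity of each `R i` keeps
  -- both in the same ball in the chart.
  have hγη : γ.Homotopic η := by
    refine homotopic_of_convex (convex_ball (WithLp.ofLp (e.φX x₀)) r)
      (f := fun z => e.φX.invFun (WithLp.toLp 2 z)) (k := fun t => WithLp.ofLp (e.φX (γ t)))
      (l := fun s => WithLp.ofLp (polar (Ξ s) (W s))) ?_ ?_ ?_ ?_ ?_ ?_ ?_ ?_ ?_
    · exact e.φX.contMDiffOn_invFun.continuousOn.comp (PiLp.continuous_toLp 2 _).continuousOn hball
    · exact (PiLp.continuous_ofLp 2 _).comp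
        (hcont.comp_continuous γ.continuous fun t => (hγ t).1)
    · exact (PiLp.continuous_ofLp 2 _).comp (continuous_polar.comp (hΞ.prodMk hW))
    · intro t
      rw [Metric.mem_ball, dist_pi_lt_iff hr]
      intro i
      obtain ⟨θ, hθ, hθ'⟩ := hVR i _ ((hγ t).2 i)
      have h1 := hRball i _ hθ
      rw [Real.sqrt_sq (norm_nonneg _), hθ'] at h1
      exact h1
    · intro s
      rw [Metric.mem_ball, dist_pi_lt_iff hr]
      intro i
      have h1 := hRc i (hwR i) (hwR' i) (by linarith [s.2.2] : 0 ≤ 1 - (s : ℝ)) s.2.1 (by ring)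
      exact hRball i _ h1
    · simp only [hΞ0, hW0, hw, γ.source]
    · simp only [hΞ1, hW1, hw', γ.target]
    · intro t
      exact (e.φX.left_inv (hγ t).1).symm
    · intro s
      simp [η, F, LocallyToricChart.toX]
  have hm : m.Homotopic (γ.map (hX.continuous_zeroSection.comp hX.continuous_μ)) := by
    refine homotopic_of_convex e.convex_disc (f := fun ξ => e.toX ξ 0) (k := Ξ)
      (l := fun t => (e.φB (μ (γ t))).1) ?_ hΞ ?_ hΞd ?_ ?_ ?_ ?_ ?_
    · exact e.continuousOn_toX.comp (by fun_prop : ContinuousOn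
        (fun ξ : EuclideanSpace ℝ (Fin n) => (ξ, (0 : Fin n → ℝ))) e.disc)
        fun ξ hξ => ⟨hξ, trivial⟩
    · exact continuous_subtype_val.comp (e.φB.contMDiffOn_toFun.continuousOn.comp_continuous
        (hX.continuous_μ.comp γ.continuous) fun t => hμ _ (hγ t).1)
    · exact fun t => e.φB_mem_disc (hμ _ (hγ t).1)
    · rw [hΞ0, hξx]
    · rw [hΞ1, hξy]
    · intro s
      simp [m, F]
    · exact fun t => hX.zeroSection_eq_toX e (hμ _ (hγ t).1)
  refine ⟨c, c', ⟨p, w, hp, fun t => ?_⟩, ⟨p', w', hp', fun t => ?_⟩, ?_⟩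
  · rw [hpw]
    simp [c, F, hΞ0, hW0]
  · rw [hpw']
    simp [c', F, hΞ1, hW1]
  · have hsq : (c.trans η).Homotopic (m.trans c') :=
      homotopic_of_square F (fun _ => rfl) (fun _ => rfl) (fun _ => rfl) (fun _ => rfl)
    exact (((Path.Homotopic.refl c).hcomp hγη).trans hsq).trans
      (hm.hcomp (Path.Homotopic.refl c'))

end IsTwistedToricManifold

end TwistedToric

end

open TwistedToric in
theorem mainTheorem3 (n : ℕ) {B X P : Type*}
    [TopologicalSpace B] [T2Space B] [CompactSpace B] [ConnectedSpace B]
    [ChartedSpace (EuclideanQuadrant n) B] [IsManifold (IQ n) ∞ B]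
    [TopologicalSpace X] [T2Space X] [CompactSpace X] [ConnectedSpace X]
    [ChartedSpace (EuclideanSpace ℝ (Fin (2 * n))) X]
    [IsManifold 𝓘(ℝ, EuclideanSpace ℝ (Fin (2 * n))) ∞ X]
    [TopologicalSpace P] [MulAction (SLZ n)ᵐᵒᵖ P]
    (πP : P → B) (hP : IsPrincipalSLBundle n πP)
    (ν : TorusBundle n P → X) (μ : X → B)
    (hX : IsTwistedToricManifold n hP ν μ)
    (hcorner : ∃ b : B, IsCornerPoint n b)
    (b : B) (x₀ : X) (hx₀ : μ x₀ = b) :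
    Function.Bijective
      (FundamentalGroup.mapOfEq ⟨μ, hX.continuous_μ⟩ hx₀ :
        FundamentalGroup X x₀ →* FundamentalGroup B b) := by
  choose c hc using hX.exists_isRadial
  -- The local radial paths depend on `γ`; uniqueness of their class lets the fixed family `c`
  -- replace them.
  have huniq : ∀ x (c' : Path (hX.zeroSection (μ x)) x), hX.IsRadial c' →
      Path.Homotopic.Quotient.mk c' = Path.Homotopic.Quotient.mk (c x) := fun x c' hc' =>
    Path.Homotopic.Quotient.eq.2 (hc'.homotopic (hX.torusLoopsTrivial hcorner _) (hc x))
  let μ' : C(X, B) := ⟨μ, hX.continuous_μ⟩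
  let ζ : C(B, X) := ⟨hX.zeroSection, hX.continuous_zeroSection⟩
  refine bijective_mapOfEq_of_natural μ' ζ hX.μ_zeroSection c (fun x t => (hc x).μ_apply t)
    (natural_of_locally_natural (ζ.comp μ') (fun x => Path.Homotopic.Quotient.mk (c x))
      fun x₁ => ?_) hx₀
  obtain ⟨V, hV, h⟩ := hX.exists_nhds_natural x₁
  refine ⟨V, hV, fun x y γ hγ => ?_⟩
  obtain ⟨c₁, c₂, h₁, h₂, hγ'⟩ := h x y γ hγ
  rw [← huniq x c₁ h₁, ← huniq y c₂ h₂]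
  exact Path.Homotopic.Quotient.eq.2 hγ'
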